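/- All graphs $G$ are finite and simple. Fix a finite set $\Omega$ of colors and a subset $\Omega_\circ\subseteq\Omega$ of looped colors. A semiproper coloring of a graph is an assignment of colors from $\Omega$ to its vertices such that no two adjacent vertices share the same non-looped color (a color in $\Omega\setminus\Omega_\circ$). For $A,B\subseteq\Omega$ and integers $a,b\ge 0$, let $c(A,B;a,b)$ be the number of semiproper colorings of the complete bipartite graph $K_{a,b}$ in which the $a$ vertices of the first part have colors in $A$ and the $b$ vertices of the second part have colors in $B$. **Theorem.** Let $G=(V,E)$ be a graph without isolated vertices, and let $d_v$ be the degree of the vertex $v$ in $G$. Assign a subset $\Omega_v\subseteq\Omega$ to each $v\in V$. Then the number of semiproper colorings of $G$ in which each $v\in V$ is assigned a color from $\Omega_v$ is at most $$\prod_{uv\in E} c(\Omega_u,\Omega_v;d_v,d_u)^{1/(d_ud_v)}.$$ In particular, for all integers $0\le\ell\le q$, $$\hom(G,K_q^{\ell\circ})\le\prod_{uv\in E}\hom(K_{d_u,d_v},K_q^{\ell\circ})^{1/(d_ud_v)},$$ where $K_q^{\ell\circ}$ is the complete graph on $q$ vertices with exactly $\ell$ of its vertices looped, and $\hom(G,H)$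 is the number of graph homomorphisms from $G$ to $H$. (The graph $G$ is not assumed to be triangle-free.) -/

import Mathlib

/-- A semiproper coloring of `G` with colors in `Ω` and set of looped colors `L`: no two adjacent
vertices of `G` share the same non-looped color. -/
def IsSemiproper {V Ω : Type*} (G : SimpleGraph V) (L : Set Ω) (f : V → Ω) : Prop :=
  ∀ u v : V, G.Adj u v → f u = f v → f u ∈ L

/-- The number of semiproper colorings of `G` in which each vertex `v` is assigned a color from
its list `C v`. -/
noncomputable def numSemiproperList {V Ω : Type*} (G : SimpleGraph V) (L : Set Ω)
    (C : V → Set Ω) : ℕ :=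
  Nat.card {f : V → Ω // IsSemiproper G L f ∧ ∀ v, f v ∈ C v}

/-- The quantity `c(A, B; a, b)`: the number of semiproper colorings of `K_{a,b}` in which the `a`
vertices of the first part have colors in `A` and the `b` vertices of the second part have colors
in `B`. -/
noncomputable def bicliqueCount {Ω : Type*} (L A B : Set Ω) (a b : ℕ) : ℕ :=
  numSemiproperList (completeBipartiteGraph (Fin a) (Fin b)) L
    (Sum.elim (fun _ => A) (fun _ => B))

theorem bicliqueCount_comm {Ω : Type*} (L A B : Set Ω) (a b : ℕ) :
    bicliqueCount L A B a b = bicliqueCount L B A b a := by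
  refine Nat.card_congr
    ((Equiv.arrowCongr (Equiv.sumComm (Fin a) (Fin b)) (Equiv.refl Ω)).subtypeEquiv ?_)
  intro f
  simp [IsSemiproper, Sum.forall, completeBipartiteGraph_adj, Equiv.arrowCongr_apply]
  tauto

/-- The factor `c(C_u, C_v; d_v, d_u) ^ (1 / (d_u d_v))` of an edge `uv` of `G`. -/
noncomputable def listEdgeFactor {V Ω : Type*} [Fintype V] (G : SimpleGraph V)
    [DecidableRel G.Adj] (L : Set Ω) (C : V → Set Ω) : Sym2 V → ℝ :=
  Sym2.lift ⟨fun u v =>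
    (bicliqueCount L (C u) (C v) (G.degree v) (G.degree u) : ℝ) ^
      (1 / ((G.degree u : ℝ) * (G.degree v : ℝ))),
    fun u v => by
      beta_reduce
      rw [bicliqueCount_comm L (C u) (C v), mul_comm (G.degree u : ℝ)]⟩

/-- The adjacency relation of `K_q^{ℓ∘}`: the complete graph on `q` vertices with exactly the
first `ℓ` of them looped (for `ℓ ≤ q`). -/
def partiallyLoopedComplete (q ℓ : ℕ) (i j : Fin q) : Prop :=
  i ≠ j ∨ i.val < ℓ

/-- The number `hom(G, H)` of homomorphisms from the graph `G` to the graph, possibly with loops,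
whose adjacency relation is `H`. -/
noncomputable def homCount {V W : Type*} (G : SimpleGraph V) (H : W → W → Prop) : ℕ :=
  Nat.card (G.Adj →r H)

theorem homCount_biclique_comm {W : Type*} (H : W → W → Prop) (a b : ℕ) :
    homCount (completeBipartiteGraph (Fin a) (Fin b)) H =
      homCount (completeBipartiteGraph (Fin b) (Fin a)) H := by
  refine Nat.card_congr
    { toFun := fun f => ⟨fun x => f x.swap, fun {x y} h => f.map_rel ?_⟩
      invFun := fun f => ⟨fun x => f x.swap, fun {x y} h => f.map_rel ?_⟩
      left_inv := fun f => ?_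
      right_inv := fun f => ?_ }
  · revert h; cases x <;> cases y <;> simp
  · revert h; cases x <;> cases y <;> simp
  · ext x; simp
  · ext x; simp

/-- The factor `hom(K_{d_u, d_v}, H) ^ (1 / (d_u d_v))` of an edge `uv` of `G`. -/
noncomputable def homEdgeFactor {V W : Type*} [Fintype V] (G : SimpleGraph V)
    [DecidableRel G.Adj] (H : W → W → Prop) : Sym2 V → ℝ :=
  Sym2.lift ⟨fun u v =>
    (homCount (completeBipartiteGraph (Fin (G.degree u)) (Fin (G.degree v))) H : ℝ) ^
      (1 / ((G.degree u : ℝ) * (G.degree v : ℝ))),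
    fun u v => by
      beta_reduce
      rw [homCount_biclique_comm H (G.degree u), mul_comm (G.degree u : ℝ)]⟩

/-! The proof is by induction on the number of edges, with isolated vertices allowed: each
contributes the size of its list. Choose `w` of maximum degree Δ > 0, sum over its color `c`, and
delete its edges. The lists of its neighbors shrink to the colors compatible with `c`, and their
degrees drop by one. It remains to see that, summed over `c`, the changes in the bound are paid for
by the factors of the deleted edges.

A surviving edge changes by at most a product of `condFactor` ratios, one for each endpoint adjacent
to `w`. With only one such endpoint this is a tautology. With two (a triangle through `w`) it is
`edgeNorm_filter_filter_le`, the step that makes triangle-freeness unnecessary. It uses the special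
form of semiproper coloring: a color `c` of the list is either harmless or excludes only itself, so
the counts to be compared are `g` and `g + 1`, and ‖g‖_p / ‖g + 1‖_p increases with p.

Hölder with exponent Δ over the neighbors `i` of `w`, and then with exponent `d_i - 1` over the
other neighbors of `i`, leaves a sum for a single ratio. This is `sum_condFactor_pow_le`; it needs
the degree of the far vertex to be at most Δ, and its bound depends only on `w` and `i`. The
resulting product is exactly that of the factors of the edges `wi`. -/

/-! ### Hölder's inequality and comparison of power sums. -/

/-- **Hölder's inequality** for a finite family of nonnegative functions, with weights. -/
theorem sum_prod_rpow_le_prod_sum_rpow {ι κ : Type*} (s : Finset ι) (t : Finset κ)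
    (f : ι → κ → ℝ) (w : ι → ℝ) (hf : ∀ i ∈ s, ∀ c ∈ t, 0 ≤ f i c) (hw : ∀ i ∈ s, 0 < w i)
    (hw1 : ∑ i ∈ s, w i = 1) :
    ∑ c ∈ t, ∏ i ∈ s, f i c ^ w i ≤ ∏ i ∈ s, (∑ c ∈ t, f i c) ^ w i := by
  have hF : ∀ i ∈ s, 0 ≤ ∑ c ∈ t, f i c := fun i hi => Finset.sum_nonneg (hf i hi)
  by_cases h0 : ∃ i ∈ s, ∑ c ∈ t, f i c = 0
  · obtain ⟨i, hi, h0⟩ := h0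
    rw [Finset.sum_eq_zero_iff_of_nonneg (hf i hi)] at h0
    rw [Finset.sum_eq_zero]
    · exact Finset.prod_nonneg fun j hj => Real.rpow_nonneg (hF j hj) _
    · intro c hc
      apply Finset.prod_eq_zero hi
      rw [h0 c hc, Real.zero_rpow (hw i hi).ne']
  · push Not at h0
    have hpos : ∀ i ∈ s, 0 < ∑ c ∈ t, f i c := fun i hi => (hF i hi).lt_of_ne' (h0 i hi)
    have key : ∑ c ∈ t, ∏ i ∈ s, (f i c / ∑ c ∈ t, f i c) ^ w i ≤ 1 := by
      calc ∑ c ∈ t, ∏ i ∈ s, (f i c / ∑ c ∈ t, f i c) ^ w i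
          ≤ ∑ c ∈ t, ∑ i ∈ s, w i * (f i c / ∑ c ∈ t, f i c) := by
            refine Finset.sum_le_sum fun c hc => ?_
            exact Real.geom_mean_le_arith_mean_weighted _ _ _ (fun i hi => (hw i hi).le) hw1
              fun i hi => div_nonneg (hf i hi c hc) (hF i hi)
        _ = ∑ i ∈ s, w i := by
            rw [Finset.sum_comm]
            refine Finset.sum_congr rfl fun i hi => ?_
            rw [← Finset.mul_sum, ← Finset.sum_div, div_self (h0 i hi), mul_one]
        _ = 1 := hw1
    have hP : 0 < ∏ i ∈ s, (∑ c ∈ t, f i c) ^ w i :=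
      Finset.prod_pos fun i hi => Real.rpow_pos_of_pos (hpos i hi) _
    have : ∑ c ∈ t, ∏ i ∈ s, (f i c / ∑ c ∈ t, f i c) ^ w i =
        (∑ c ∈ t, ∏ i ∈ s, f i c ^ w i) / ∏ i ∈ s, (∑ c ∈ t, f i c) ^ w i := by
      rw [Finset.sum_div]
      refine Finset.sum_congr rfl fun c hc => ?_
      rw [← Finset.prod_div_distrib]
      exact Finset.prod_congr rfl fun i hi => Real.div_rpow (hf i hi c hc) (hF i hi) _
    rwa [this, div_le_one hP] at key

/-- Hölder's inequality for a product of `n` nonnegative functions, all in `L^n`. -/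
theorem sum_prod_le_prod_sum_pow {ι κ : Type*} (s : Finset ι) (t : Finset κ)
    (f : ι → κ → ℝ) (hf : ∀ i ∈ s, ∀ c ∈ t, 0 ≤ f i c) (hs : s.Nonempty) :
    ∑ c ∈ t, ∏ i ∈ s, f i c ≤ ∏ i ∈ s, (∑ c ∈ t, f i c ^ s.card) ^ (1 / (s.card : ℝ)) := by
  have hn : s.card ≠ 0 := hs.card_pos.ne'
  have := sum_prod_rpow_le_prod_sum_rpow s t (fun i c => f i c ^ s.card)
    (fun _ => 1 / (s.card : ℝ)) (fun i hi c hc => pow_nonneg (hf i hi c hc) _)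
    (fun i hi => by positivity) (by simp [hn])
  refine le_trans (le_of_eq ?_) this
  refine Finset.sum_congr rfl fun c hc => Finset.prod_congr rfl fun i hi => ?_
  rw [one_div, Real.pow_rpow_inv_natCast (hf i hi c hc) hn]

/-- This is weighted AM-GM, obtained from Bernoulli's inequality for `u / g`. -/
theorem succ_mul_mul_pow_le (p : ℕ) {g u : ℝ} (hg : 0 ≤ g) (hu : 0 ≤ u) :
    (p + 1) * (u * g ^ p) ≤ p * g ^ (p + 1) + u ^ (p + 1) := by
  rcases hg.eq_or_lt with rfl | hg
  · rcases p with _ | p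
    · simp
    · simp [pow_nonneg hu]
  · have h := one_add_mul_le_pow (a := u / g - 1) (by have := div_nonneg hu hg.le; linarith) (p + 1)
    have h2 := mul_le_mul_of_nonneg_right h (pow_pos hg (p + 1)).le
    rw [add_sub_cancel, div_pow, div_mul_cancel₀ _ (pow_pos hg (p + 1)).ne'] at h2
    have h3 : (1 + ((p + 1 : ℕ) : ℝ) * (u / g - 1)) * g ^ (p + 1) =
        (p + 1) * (u * g ^ p) - p * g ^ (p + 1) := by
      push_cast
      field_simp
      ring
    linarith

/-- The ratio of the `ℓ^p` norms of `g` and `g + 1` increases with `p`. -/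
theorem sum_pow_div_sum_succ_pow_mono {ι : Type*} (J : Finset ι) (g : ι → ℝ)
    (hg : ∀ y ∈ J, 0 ≤ g y) {p : ℕ} (hp : 0 < p) {l : ℝ} (hl0 : 0 ≤ l) (hl1 : l < 1)
    (hl : ∑ y ∈ J, g y ^ p = l ^ p * ∑ y ∈ J, (g y + 1) ^ p) :
    l ^ (p + 1) * ∑ y ∈ J, (g y + 1) ^ (p + 1) ≤ ∑ y ∈ J, g y ^ (p + 1) := by
  set τ := l / (1 - l) with hτ
  have hl1' : 0 < 1 - l := by linarith
  have hτl : l * (τ + 1) = τ := by rw [hτ]; field_simp; ring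
  have hτ0 : 0 ≤ τ := by positivity
  have hp' : (0 : ℝ) < p := by exact_mod_cast hp
  have key : ∀ y ∈ J, (p + 1) * τ * (g y ^ p - l ^ p * (g y + 1) ^ p) ≤
      p * (g y ^ (p + 1) - l ^ (p + 1) * (g y + 1) ^ (p + 1)) := by
    intro y hy
    have hgy := hg y hy
    rw [← mul_pow, ← mul_pow]
    set u := l * (g y + 1) with hu
    have hu0 : 0 ≤ u := by positivity
    have h1 := succ_mul_mul_pow_le p hgy hu0
    -- Both `u - τ` and `g y - u` have the sign of `g y - τ`. Replacing `u` by the constant `τ`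
    -- makes the left side summable by means of `hl`.
    have h2 : τ * (g y ^ p - u ^ p) ≤ u * (g y ^ p - u ^ p) := by
      have e1 : u - τ = l * (g y - τ) := by rw [hu]; linear_combination hτl
      have e2 : g y - u = (1 - l) * (g y - τ) := by
        rw [hu]; linear_combination (-1 : ℝ) * hτl
      rcases le_total τ (g y) with h | h
      · have a1 : τ ≤ u := by
          have := mul_nonneg hl0 (sub_nonneg.2 h); linarith
        have a2 : u ≤ g y := by
          have := mul_nonneg hl1'.le (sub_nonneg.2 h); linarith
        have := pow_le_pow_left₀ hu0 a2 p
        exact mul_le_mul_of_nonneg_right a1 (by linarith)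
      · have a1 : u ≤ τ := by
          have := mul_nonneg hl0 (sub_nonneg.2 h); linarith
        have a2 : g y ≤ u := by
          have := mul_nonneg hl1'.le (sub_nonneg.2 h); linarith
        have := pow_le_pow_left₀ hgy a2 p
        exact mul_le_mul_of_nonpos_right a1 (by linarith)
    have h3 : (p + 1) * (τ * (g y ^ p - u ^ p)) ≤ (p + 1) * (u * (g y ^ p - u ^ p)) :=
      mul_le_mul_of_nonneg_left h2 (by linarith)
    have h4 : u ^ (p + 1) = u * u ^ p := by ring
    nlinarith [h1, h3, h4]
  have hs := Finset.sum_le_sum key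
  rw [← Finset.mul_sum, ← Finset.mul_sum, Finset.sum_sub_distrib, Finset.sum_sub_distrib,
    ← Finset.mul_sum, ← Finset.mul_sum, hl, sub_self, mul_zero] at hs
  have := nonneg_of_mul_nonneg_right hs hp'
  linarith

/-- Let `l` be the ratio of the `ℓ^p` norms of `g` and `G` on `J`. On `J`, monotonicity in the
exponent shows that the ratio of the `ℓ^(p+1)` norms is at least `l`. Off `J` the functions agree,
which only helps since `l < 1`. -/
theorem rpow_sum_pow_mul_le_of_add_one {ι : Type*} [DecidableEq ι] {I J : Finset ι} (hJ : J ⊆ I)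
    (g G : ι → ℝ) (hg : ∀ y ∈ I, 0 ≤ g y) (hG : ∀ y ∈ J, G y = g y + 1)
    (hG' : ∀ y ∈ I, y ∉ J → G y = g y) {p : ℕ} (hp : 0 < p) :
    (∑ y ∈ J, g y ^ p) ^ (1 / (p : ℝ)) * (∑ y ∈ I, G y ^ (p + 1)) ^ (1 / ((p + 1 : ℕ) : ℝ)) ≤
      (∑ y ∈ I, g y ^ (p + 1)) ^ (1 / ((p + 1 : ℕ) : ℝ)) *
        (∑ y ∈ J, G y ^ p) ^ (1 / (p : ℝ)) := by
  have hgJ : ∀ y ∈ J, 0 ≤ g y := fun y hy => hg y (hJ hy)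
  have hG0 : ∀ y ∈ I, 0 ≤ G y := by
    intro y hy
    by_cases h : y ∈ J
    · rw [hG y h]; have := hg y hy; linarith
    · rw [hG' y hy h]; exact hg y hy
  have hGI : 0 ≤ ∑ y ∈ I, G y ^ (p + 1) := Finset.sum_nonneg fun y hy => pow_nonneg (hG0 y hy) _
  have hgI : 0 ≤ ∑ y ∈ I, g y ^ (p + 1) := Finset.sum_nonneg fun y hy => pow_nonneg (hg y hy) _
  set α := ∑ y ∈ J, g y ^ p with hα
  set β := ∑ y ∈ J, G y ^ p with hβ
  have hα0 : 0 ≤ α := Finset.sum_nonneg fun y hy => pow_nonneg (hgJ y hy) _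
  have hβ0 : 0 ≤ β := Finset.sum_nonneg fun y hy => pow_nonneg (hG0 y (hJ hy)) _
  rcases hα0.eq_or_lt with h0 | hαpos
  · rw [← h0, Real.zero_rpow (by positivity), zero_mul]
    positivity
  have hJne : J.Nonempty := by
    rw [Finset.nonempty_iff_ne_empty]
    rintro rfl
    simp [hα] at hαpos
  have hlt : α < β := by
    refine Finset.sum_lt_sum_of_nonempty hJne fun y hy => ?_
    rw [hG y hy]
    exact pow_lt_pow_left₀ (by linarith) (hgJ y hy) hp.ne'
  have hβpos : 0 < β := hαpos.trans hlt
  set l := (α / β) ^ (1 / (p : ℝ)) with hl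
  have hl0 : 0 ≤ l := by positivity
  have hl1 : l < 1 := Real.rpow_lt_one (by positivity) ((div_lt_one hβpos).2 hlt) (by positivity)
  have hlp : l ^ p = α / β := by
    rw [hl, one_div, Real.rpow_inv_natCast_pow (by positivity) hp.ne']
  have hβ' : β = ∑ y ∈ J, (g y + 1) ^ p := Finset.sum_congr rfl fun y hy => by rw [hG y hy]
  have hmono := sum_pow_div_sum_succ_pow_mono J g hgJ hp hl0 hl1
    (by rw [← hβ', hlp, div_mul_cancel₀ _ hβpos.ne'])
  have hI : l ^ (p + 1) * ∑ y ∈ I, G y ^ (p + 1) ≤ ∑ y ∈ I, g y ^ (p + 1) := by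
    rw [← Finset.sum_sdiff hJ, ← Finset.sum_sdiff hJ (f := fun y => g y ^ (p + 1)), mul_add]
    refine add_le_add ?_ ?_
    · rw [Finset.mul_sum]
      refine Finset.sum_le_sum fun y hy => ?_
      rw [Finset.mem_sdiff] at hy
      rw [hG' y hy.1 hy.2]
      exact mul_le_of_le_one_left (pow_nonneg (hg y hy.1) _) (pow_le_one₀ hl0 hl1.le)
    · rwa [Finset.sum_congr rfl fun y hy => by rw [hG y hy]]
  have hroot := Real.rpow_le_rpow (by positivity) hI (z := 1 / ((p + 1 : ℕ) : ℝ)) (by positivity)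
  rw [Real.mul_rpow (by positivity) hGI, one_div, Real.pow_rpow_inv_natCast hl0 (by simp)] at hroot
  have hαβ : α ^ (1 / (p : ℝ)) = l * β ^ (1 / (p : ℝ)) := by
    rw [hl, ← Real.mul_rpow (by positivity) hβ0, div_mul_cancel₀ _ hβpos.ne']
  rw [hαβ, one_div ((p + 1 : ℕ) : ℝ), mul_right_comm]
  exact mul_le_mul_of_nonneg_right hroot (by positivity)

/-! ### Counting colorings of bicliques. -/

/-- The colors `x` and `y` may be given to adjacent vertices when `L` is the set of looped
colors. -/
def Compat {Ω : Type*} (L : Set Ω) (x y : Ω) : Prop := x = y → x ∈ L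

noncomputable instance {Ω : Type*} (L : Set Ω) : DecidableRel (Compat L) := Classical.decRel _

theorem Compat.symm {Ω : Type*} {L : Set Ω} {x y : Ω} (h : Compat L x y) : Compat L y x :=
  fun e => e ▸ h e.symm

/-- The colors of `B` that are compatible with all the colors `x i`. -/
noncomputable def avail {ι Ω : Type*} [Fintype ι] (L : Set Ω) (B : Finset Ω) (x : ι → Ω) :
    Finset Ω :=
  B.filter fun y => ∀ i, Compat L (x i) y

/-- The number of semiproper colorings of `K_{s,t}` with lists `A` and `B`. -/
noncomputable def bic {Ω : Type*} (L : Set Ω) (A B : Finset Ω) (s t : ℕ) : ℝ :=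
  ∑ x ∈ Fintype.piFinset fun _ : Fin s => A, ((avail L B x).card : ℝ) ^ t

theorem mem_avail {ι Ω : Type*} [Fintype ι] {L : Set Ω} {B : Finset Ω} {x : ι → Ω} {y : Ω} :
    y ∈ avail L B x ↔ y ∈ B ∧ ∀ i, Compat L (x i) y := by
  simp [avail]

theorem bicliqueCount_eq_bic {Ω : Type*} [Finite Ω] (L : Set Ω) (A B : Finset Ω) (s t : ℕ) :
    (bicliqueCount L A B s t : ℝ) = bic L A B s t := by
  classical
  have := Fintype.ofFinite Ω
  have e : {f : Fin s ⊕ Fin t → Ω //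
      IsSemiproper (completeBipartiteGraph (Fin s) (Fin t)) L f ∧
        ∀ v, f v ∈ (Sum.elim (fun _ => (A : Set Ω)) (fun _ => (B : Set Ω)) v : Set Ω)} ≃
      (Fintype.piFinset fun _ : Fin s => A).sigma
        fun x => Fintype.piFinset fun _ : Fin t => avail L B x := by
    refine
      { toFun := fun f => ⟨⟨fun i => f.1 (Sum.inl i), fun j => f.1 (Sum.inr j)⟩, ?_⟩
        invFun := fun p => ⟨Sum.elim p.1.1 p.1.2, ?_⟩
        left_inv := fun f => ?_
        right_inv := fun p => ?_ }
    · obtain ⟨f, h1, h2⟩ := f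
      simp only [Finset.mem_sigma, Fintype.mem_piFinset, mem_avail]
      exact ⟨fun i => by simpa using h2 (Sum.inl i),
        fun j => ⟨by simpa using h2 (Sum.inr j), fun i => h1 _ _ (by simp)⟩⟩
    · obtain ⟨⟨x, y⟩, h⟩ := p
      simp only [Finset.mem_sigma, Fintype.mem_piFinset, mem_avail] at h
      refine ⟨?_, ?_⟩
      · rintro (i | i) (j | j) hadj
        · simp at hadj
        · exact (h.2 j).2 i
        · exact ((h.2 i).2 j).symm
        · simp at hadj
      · rintro (i | i)
        · exact h.1 i
        · exact (h.2 i).1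
    · ext (i | i) <;> rfl
    · rfl
  unfold bicliqueCount numSemiproperList bic
  rw [Nat.card_congr e, Nat.card_eq_fintype_card, Fintype.card_coe, Finset.card_sigma]
  push_cast
  simp

theorem bic_comm {Ω : Type*} [Finite Ω] (L : Set Ω) (A B : Finset Ω) (s t : ℕ) :
    bic L A B s t = bic L B A t s := by
  rw [← bicliqueCount_eq_bic, ← bicliqueCount_eq_bic, bicliqueCount_comm]

theorem bic_nonneg {Ω : Type*} (L : Set Ω) (A B : Finset Ω) (s t : ℕ) : 0 ≤ bic L A B s t :=
  Finset.sum_nonneg fun _ _ => by positivity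

/-- For positive `s` and `t`, a coloring of `K_{s,t}` exists as soon as there are compatible
colors. -/
theorem bic_eq_zero_iff {Ω : Type*} (L : Set Ω) (A B : Finset Ω) {s t : ℕ} (hs : 0 < s)
    (ht : 0 < t) : bic L A B s t = 0 ↔ ∀ x ∈ A, ∀ y ∈ B, ¬ Compat L x y := by
  unfold bic
  rw [Finset.sum_eq_zero_iff_of_nonneg fun _ _ => by positivity]
  simp only [pow_eq_zero_iff ht.ne', Nat.cast_eq_zero, Finset.card_eq_zero, Fintype.mem_piFinset,
    Finset.eq_empty_iff_forall_notMem, mem_avail, not_and, not_forall]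
  constructor
  · intro h x hx y hy hxy
    obtain ⟨i, hi⟩ := h (fun _ => x) (fun _ => hx) y hy
    exact hi hxy
  · intro h x hx y hy
    exact ⟨⟨0, hs⟩, h _ (hx _) y hy⟩

/-! ### The sum over the color of the deleted vertex. -/

/-- Solves a self-referential Hölder bound: the power `T ^ (1 - 1 / p)` on the right is cancelled,
and the rest is raised to the power `p`. -/
theorem le_rpow_mul_of_le_mul_rpow {n : ℕ} {T U b p : ℝ} (hT : 0 ≤ T) (hU : 0 ≤ U) (hb : 0 ≤ b)
    (hp : 0 < p)
    (h : T ≤ U * ((T ^ (n + 1)) ^ (1 - 1 / p) * b ^ (1 / p)) ^ (1 / ((n : ℝ) + 1))) :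
    T ≤ U ^ p * b ^ (1 / ((n : ℝ) + 1)) := by
  rcases hT.eq_or_lt with h0 | hTpos
  · rw [← h0]; positivity
  have e : ((T ^ (n + 1)) ^ (1 - 1 / p) * b ^ (1 / p)) ^ (1 / ((n : ℝ) + 1)) =
      T ^ (1 - 1 / p) * (b ^ (1 / ((n : ℝ) + 1))) ^ (1 / p) := by
    rw [Real.mul_rpow (by positivity) (by positivity), ← Real.rpow_mul hb, ← Real.rpow_mul hb,
      mul_comm (1 / p), ← Real.rpow_natCast, ← Real.rpow_mul hT, ← Real.rpow_mul hT]
    congr 2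
    push_cast
    field_simp
  rw [e] at h
  have h5 : T ^ (1 / p) ≤ U * (b ^ (1 / ((n : ℝ) + 1))) ^ (1 / p) := by
    have hpos : 0 < T ^ (1 - 1 / p) := Real.rpow_pos_of_pos hTpos _
    refine le_of_mul_le_mul_left ?_ hpos
    rw [← Real.rpow_add hTpos, sub_add_cancel, Real.rpow_one]
    linarith
  have h6 := Real.rpow_le_rpow (by positivity) h5 hp.le
  have hc : 0 ≤ b ^ (1 / ((n : ℝ) + 1)) := by positivity
  rwa [Real.mul_rpow hU (by positivity), ← Real.rpow_mul hT, ← Real.rpow_mul hc,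
    one_div_mul_cancel hp.ne', Real.rpow_one, Real.rpow_one] at h6

/-- A duality argument. With `T` the left side, write `X c ^ p = X c ^ (p - 1) * X c` and exchange
the sums over `c` and `x`. Hölder in `x` splits off `S`. The remaining power expands over tuples of
colors, and a second Hölder bounds it by a power of `T` times a power of the biclique count. Solving
for `T` gives the result. -/
theorem sum_rpow_le_of_compat {Ω : Type*} (L : Set Ω) (A W : Finset Ω)
    {n r Δ : ℕ} (hn : 0 < n) (hr : 0 < r) (hrΔ : r ≤ Δ) (S : (Fin r → Ω) → ℝ)
    (hS : ∀ x, 0 ≤ S x) :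
    ∑ c ∈ W, (∑ x ∈ Fintype.piFinset fun _ : Fin r => A.filter (Compat L c), S x ^ n) ^
        ((Δ : ℝ) / r) ≤
      ((∑ x ∈ Fintype.piFinset fun _ : Fin r => A, S x ^ (n + 1)) ^ ((n : ℝ) / (n + 1))) ^
        ((Δ : ℝ) / r) * bic L W A (n + 1) Δ ^ (1 / ((n : ℝ) + 1)) := by
  classical
  have hn' : (0 : ℝ) < n := by exact_mod_cast hn
  have hr' : (0 : ℝ) < r := by exact_mod_cast hr
  set p : ℝ := (Δ : ℝ) / r with hp
  have hp1 : 1 ≤ p := by rw [hp, one_le_div hr']; exact_mod_cast hrΔ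
  have hp0 : 0 < p := by linarith
  set k : Ω → (Fin r → Ω) → ℝ := fun c x => if ∀ l, Compat L c (x l) then 1 else 0 with hk
  have hk0 : ∀ c x, 0 ≤ k c x := fun c x => by simp only [hk]; split_ifs <;> simp
  set X : Ω → ℝ := fun c =>
    ∑ x ∈ Fintype.piFinset fun _ : Fin r => A.filter (Compat L c), S x ^ n with hX
  have hX0 : ∀ c, 0 ≤ X c := fun c => Finset.sum_nonneg fun x _ => pow_nonneg (hS x) _
  have hXk : ∀ c, X c = ∑ x ∈ Fintype.piFinset fun _ : Fin r => A, S x ^ n * k c x := by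
    intro c
    simp only [hX, hk, mul_ite, mul_one, mul_zero]
    rw [← Finset.sum_filter]
    refine Finset.sum_congr ?_ fun _ _ => rfl
    ext x
    simp [Fintype.mem_piFinset, forall_and]
  set q : Ω → ℝ := fun c => X c ^ (p - 1) with hq
  have hq0 : ∀ c, 0 ≤ q c := fun c => Real.rpow_nonneg (hX0 c) _
  have hqX : ∀ c, X c ^ p = q c * X c := by
    intro c
    rcases (hX0 c).eq_or_lt with h | h
    · rw [← h, Real.zero_rpow hp0.ne', mul_zero]
    · rw [hq, ← Real.rpow_add_one h.ne', sub_add_cancel]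
  set T := ∑ c ∈ W, X c ^ p with hT
  have hT0 : 0 ≤ T := Finset.sum_nonneg fun c _ => Real.rpow_nonneg (hX0 c) _
  set U := ∑ x ∈ Fintype.piFinset fun _ : Fin r => A, S x ^ (n + 1) with hU
  have hU0 : 0 ≤ U := Finset.sum_nonneg fun x _ => pow_nonneg (hS x) _
  have hb0 : 0 ≤ bic L W A (n + 1) Δ := bic_nonneg ..
  have h1 : T ≤ U ^ ((n : ℝ) / (n + 1)) *
      (∑ x ∈ Fintype.piFinset fun _ : Fin r => A, (∑ c ∈ W, q c * k c x) ^ (n + 1)) ^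
        (1 / ((n : ℝ) + 1)) := by
    have hconj : Real.HolderConjugate (((n : ℝ) + 1) / n) ((n : ℝ) + 1) := by
      rw [Real.holderConjugate_iff]
      refine ⟨by rw [one_lt_div hn']; linarith, ?_⟩
      field_simp
    have := Real.inner_le_Lp_mul_Lq_of_nonneg (Fintype.piFinset fun _ : Fin r => A) hconj
      (f := fun x => S x ^ n) (g := fun x => ∑ c ∈ W, q c * k c x)
      (fun x _ => pow_nonneg (hS x) _)
      (fun x _ => Finset.sum_nonneg fun c _ => mul_nonneg (hq0 c) (hk0 c x))
    have e1 : ∀ x, (S x ^ n) ^ (((n : ℝ) + 1) / n) = S x ^ (n + 1) := by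
      intro x
      rw [← Real.rpow_natCast, ← Real.rpow_mul (hS x), mul_div_cancel₀ _ hn'.ne',
        ← Real.rpow_natCast]
      push_cast; rfl
    have e2 : ∀ y : ℝ, y ^ ((n : ℝ) + 1) = y ^ (n + 1) := by
      intro y
      rw [← Real.rpow_natCast]; push_cast; rfl
    simp only [e1, e2, one_div_div] at this
    refine le_trans (le_of_eq ?_) this
    calc T = ∑ c ∈ W, ∑ x ∈ Fintype.piFinset fun _ : Fin r => A, q c * (S x ^ n * k c x) :=
          Finset.sum_congr rfl fun c _ => by rw [hqX, hXk, Finset.mul_sum]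
      _ = _ := by
          rw [Finset.sum_comm]
          refine Finset.sum_congr rfl fun x _ => ?_
          rw [Finset.mul_sum]
          exact Finset.sum_congr rfl fun c _ => mul_left_comm _ _ _
  -- Expanding the power gives `n + 1` independent colors `c m`; the tuples `x` compatible with all
  -- of them number `(avail L A c).card ^ r`.
  have h2 : ∑ x ∈ Fintype.piFinset fun _ : Fin r => A, (∑ c ∈ W, q c * k c x) ^ (n + 1) =
      ∑ c ∈ Fintype.piFinset fun _ : Fin (n + 1) => W,
        (∏ m, q (c m)) * ((avail L A c).card : ℝ) ^ r := by
    simp only [Finset.sum_pow', Finset.prod_mul_distrib]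
    rw [Finset.sum_comm]
    refine Finset.sum_congr rfl fun c _ => ?_
    rw [← Finset.mul_sum]
    congr 1
    have : ∀ x : Fin r → Ω, ∏ m, k (c m) x = if ∀ m l, Compat L (c m) (x l) then 1 else 0 := by
      intro x
      simp only [hk]
      rw [Fintype.prod_ite_zero]
      simp
    simp only [this]
    rw [← Finset.sum_filter, Finset.sum_const, nsmul_one]
    norm_cast
    have hpi : ((Fintype.piFinset fun _ : Fin r => avail L A c).card) = (avail L A c).card ^ r := by
      simp
    rw [← hpi]
    congr 1
    ext x
    simp only [Finset.mem_filter, Fintype.mem_piFinset, mem_avail]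
    exact ⟨fun h l => ⟨h.1 l, fun m => h.2 m l⟩, fun h => ⟨fun l => (h l).1, fun m l => (h l).2 m⟩⟩
  have h3 : ∑ c ∈ Fintype.piFinset fun _ : Fin (n + 1) => W,
        (∏ m, q (c m)) * ((avail L A c).card : ℝ) ^ r ≤
      (T ^ (n + 1)) ^ (1 - 1 / p) * bic L W A (n + 1) Δ ^ (1 / p) := by
    -- At `p = 1` there is no finite conjugate exponent, but then `q` is identically 1 and both
    -- sides agree.
    rcases hp1.eq_or_lt with h | h
    · have hΔ : Δ = r := by
        rw [hp, eq_div_iff hr'.ne', one_mul] at h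
        exact_mod_cast h.symm
      have : ∀ c, q c = 1 := fun c => by rw [hq, ← h]; simp
      simp only [this, ← h, hΔ]
      simp [bic]
    · have hconj := Real.HolderConjugate.conjExponent h
      have := Real.inner_le_Lp_mul_Lq_of_nonneg (Fintype.piFinset fun _ : Fin (n + 1) => W)
        hconj.symm (f := fun c => ∏ m, q (c m)) (g := fun c => ((avail L A c).card : ℝ) ^ r)
        (fun c _ => Finset.prod_nonneg fun m _ => hq0 _) (fun c _ => by positivity)
      have e1 : ∀ c : Fin (n + 1) → Ω, (∏ m, q (c m)) ^ p.conjExponent = ∏ m, X (c m) ^ p := by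
        intro c
        rw [← Real.finsetProd_rpow _ _ fun m _ => hq0 _]
        refine Finset.prod_congr rfl fun m _ => ?_
        rw [hq, ← Real.rpow_mul (hX0 _), Real.conjExponent,
          mul_div_cancel₀ _ (by linarith : p - 1 ≠ 0)]
      have e2 : ∀ c : Fin (n + 1) → Ω, (((avail L A c).card : ℝ) ^ r) ^ p =
          ((avail L A c).card : ℝ) ^ Δ := by
        intro c
        rw [← Real.rpow_natCast, ← Real.rpow_mul (by positivity), hp,
          mul_div_cancel₀ _ hr'.ne', Real.rpow_natCast]
      have e3 : 1 / p.conjExponent = 1 - 1 / p := by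
        have := hconj.inv_add_inv_eq_one
        rw [one_div, one_div]; linarith
      simp only [e1, e2, e3] at this
      rwa [← Finset.sum_pow' W (fun c => X c ^ p)] at this
  rw [h2] at h1
  refine le_rpow_mul_of_le_mul_rpow hT0 (Real.rpow_nonneg hU0 _) hb0 hp0 (h1.trans ?_)
  refine mul_le_mul_of_nonneg_left ?_ (Real.rpow_nonneg hU0 _)
  exact Real.rpow_le_rpow (Finset.sum_nonneg fun c _ => mul_nonneg
      (Finset.prod_nonneg fun m _ => hq0 _) (by positivity)) h3 (by positivity)

/-- The factor by which restricting the list `A` to the colors compatible with `c` changes the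
normalized number of colorings of a biclique. -/
noncomputable def condFactor {Ω : Type*} (L : Set Ω) (A B : Finset Ω) (n r : ℕ) (c : Ω) : ℝ :=
  bic L (A.filter (Compat L c)) B r n ^ (1 / ((r : ℝ) * n)) /
    bic L A B r (n + 1) ^ (1 / ((r : ℝ) * (n + 1)))

theorem condFactor_nonneg {Ω : Type*} (L : Set Ω) (A B : Finset Ω) (n r : ℕ) (c : Ω) :
    0 ≤ condFactor L A B n r c :=
  div_nonneg (Real.rpow_nonneg (bic_nonneg ..) _) (Real.rpow_nonneg (bic_nonneg ..) _)

/-- The case where `S` counts available colors: `S` then cancels against the denominator of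
`condFactor`, so the bound involves neither `B` nor `r`. -/
theorem sum_condFactor_pow_le {Ω : Type*} (L : Set Ω) (A B W : Finset Ω)
    {n r Δ : ℕ} (hn : 0 < n) (hr : 0 < r) (hrΔ : r ≤ Δ) :
    ∑ c ∈ W, condFactor L A B n r c ^ (n * Δ) ≤ bic L W A (n + 1) Δ ^ (1 / ((n : ℝ) + 1)) := by
  have hn' : (0 : ℝ) < n := by exact_mod_cast hn
  have hr' : (0 : ℝ) < r := by exact_mod_cast hr
  have hb0 : 0 ≤ bic L W A (n + 1) Δ := bic_nonneg ..
  have hZ0 : 0 ≤ bic L A B r (n + 1) := bic_nonneg ..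
  have e : ∀ c, condFactor L A B n r c ^ (n * Δ) =
      bic L (A.filter (Compat L c)) B r n ^ ((Δ : ℝ) / r) /
        (bic L A B r (n + 1) ^ ((n : ℝ) / (n + 1))) ^ ((Δ : ℝ) / r) := by
    intro c
    rw [condFactor, div_pow, ← Real.rpow_natCast, ← Real.rpow_natCast,
      ← Real.rpow_mul (bic_nonneg ..), ← Real.rpow_mul hZ0, ← Real.rpow_mul hZ0]
    congr 2
    · push_cast; field_simp
    · push_cast; field_simp
  simp only [e]
  rw [← Finset.sum_div]
  refine div_le_of_le_mul₀ (by positivity) (by positivity) ?_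
  rw [mul_comm]
  exact sum_rpow_le_of_compat L A W hn hr hrΔ (fun x => ((avail L B x).card : ℝ))
    fun _ => by positivity

/-! ### Change of an edge factor when a color is imposed nearby. -/

/-- Count from the `B` side, over tuples `y` in `B ^ n`. If `c` is a non-looped color of `A`, then
the tuples avoiding `c` have `c` as one extra available color in `A`, and on all other tuples the
two counts agree. Otherwise filtering `A` changes nothing and equality holds. -/
theorem bic_filter_filter_mul_le {Ω : Type*} [Finite Ω] (L : Set Ω) (A B : Finset Ω) (c : Ω)
    {n p : ℕ} (hp : 0 < p) :
    bic L (A.filter (Compat L c)) (B.filter (Compat L c)) p n ^ (1 / ((p : ℝ) * n)) *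
        bic L A B (p + 1) n ^ (1 / (((p + 1 : ℕ) : ℝ) * n)) ≤
      bic L (A.filter (Compat L c)) B (p + 1) n ^ (1 / (((p + 1 : ℕ) : ℝ) * n)) *
        bic L A (B.filter (Compat L c)) p n ^ (1 / ((p : ℝ) * n)) := by
  classical
  by_cases hc : c ∈ A ∧ c ∉ L
  · have hJ : (Fintype.piFinset fun _ : Fin n => B.filter (Compat L c)) ⊆
        Fintype.piFinset fun _ : Fin n => B :=
      Fintype.piFinset_subset _ _ fun _ => Finset.filter_subset _ _
    have hcompat : ∀ y, Compat L c y ↔ y ≠ c := fun y =>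
      ⟨fun h e => hc.2 (h e.symm), fun h e => absurd e.symm h⟩
    have hG : ∀ y ∈ Fintype.piFinset fun _ : Fin n => B.filter (Compat L c),
        ((avail L A y).card : ℝ) = (avail L (A.filter (Compat L c)) y).card + 1 := by
      intro y hy
      simp only [Fintype.mem_piFinset, Finset.mem_filter] at hy
      have : avail L A y = insert c (avail L (A.filter (Compat L c)) y) := by
        ext z
        simp only [mem_avail, Finset.mem_insert, Finset.mem_filter, hcompat]
        constructor
        · intro h
          by_cases hz : z = c
          · exact Or.inl hz
          · exact Or.inr ⟨⟨h.1, hz⟩, h.2⟩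
        · rintro (rfl | h)
          · exact ⟨hc.1, fun i => (hy i).2.symm⟩
          · exact ⟨h.1.1, h.2⟩
      rw [this, Finset.card_insert_of_notMem (by simp [mem_avail, hcompat])]
      push_cast
      rfl
    have hG' : ∀ y ∈ Fintype.piFinset fun _ : Fin n => B,
        (y ∉ Fintype.piFinset fun _ : Fin n => B.filter (Compat L c)) →
        ((avail L A y).card : ℝ) = (avail L (A.filter (Compat L c)) y).card := by
      intro y hy hyJ
      simp only [Fintype.mem_piFinset, Finset.mem_filter, hcompat] at hy hyJ
      push Not at hyJ
      obtain ⟨i, hi⟩ := hyJ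
      have hi := hi (hy i)
      congr 2
      ext z
      simp only [mem_avail, Finset.mem_filter, hcompat]
      refine ⟨fun h => ⟨⟨h.1, ?_⟩, h.2⟩, fun h => ⟨h.1.1, h.2⟩⟩
      rintro rfl
      exact hc.2 (hi ▸ h.2 i hi)
    have key : bic L (B.filter (Compat L c)) (A.filter (Compat L c)) n p ^ (1 / (p : ℝ)) *
        bic L B A n (p + 1) ^ (1 / ((p + 1 : ℕ) : ℝ)) ≤
        bic L B (A.filter (Compat L c)) n (p + 1) ^ (1 / ((p + 1 : ℕ) : ℝ)) *
        bic L (B.filter (Compat L c)) A n p ^ (1 / (p : ℝ)) :=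
      rpow_sum_pow_mul_le_of_add_one hJ _ _ (fun _ _ => Nat.cast_nonneg _) hG hG' hp
    have h0 : ∀ (A B : Finset Ω) (k : ℕ), 0 ≤ bic L B A n k ^ (1 / (k : ℝ)) :=
      fun A B k => Real.rpow_nonneg (bic_nonneg ..) _
    have h1 : ∀ (A B : Finset Ω) (k : ℕ), (bic L B A n k ^ (1 / (k : ℝ))) ^ (1 / (n : ℝ)) =
        bic L A B k n ^ (1 / ((k : ℝ) * n)) := by
      intro A B k
      rw [← Real.rpow_mul (bic_nonneg ..), bic_comm, div_mul_div_comm, one_mul]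
    have hroot := Real.rpow_le_rpow (mul_nonneg (h0 ..) (h0 ..)) key
      (z := 1 / (n : ℝ)) (by positivity)
    rw [Real.mul_rpow (h0 ..) (h0 ..), Real.mul_rpow (h0 ..) (h0 ..), h1, h1, h1, h1] at hroot
    exact hroot
  · have hA : A.filter (Compat L c) = A := by
      rw [Finset.filter_eq_self]
      rintro x hx rfl
      by_contra hxL
      exact hc ⟨hx, hxL⟩
    rw [hA, mul_comm]

/-- The normalized number of colorings of a biclique that is associated with an edge whose ends
have lists `A`, `B` and degrees `a`, `b`. -/
noncomputable def edgeNorm {Ω : Type*} (L : Set Ω) (A B : Finset Ω) (a b : ℕ) : ℝ :=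
  bic L A B b a ^ (1 / ((b : ℝ) * a))

theorem edgeNorm_nonneg {Ω : Type*} (L : Set Ω) (A B : Finset Ω) (a b : ℕ) :
    0 ≤ edgeNorm L A B a b := Real.rpow_nonneg (bic_nonneg ..) _

theorem edgeNorm_comm {Ω : Type*} [Finite Ω] (L : Set Ω) (A B : Finset Ω) (a b : ℕ) :
    edgeNorm L A B a b = edgeNorm L B A b a := by
  rw [edgeNorm, edgeNorm, bic_comm, mul_comm (b : ℝ)]

theorem condFactor_eq {Ω : Type*} (L : Set Ω) (A B : Finset Ω) (n r : ℕ) (c : Ω) :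
    condFactor L A B n r c =
      edgeNorm L (A.filter (Compat L c)) B n r / edgeNorm L A B (n + 1) r := by
  simp [condFactor, edgeNorm]

theorem edgeNorm_eq_zero_iff {Ω : Type*} (L : Set Ω) (A B : Finset Ω) {a b : ℕ} (ha : 0 < a)
    (hb : 0 < b) : edgeNorm L A B a b = 0 ↔ ∀ x ∈ A, ∀ y ∈ B, ¬ Compat L x y := by
  rw [edgeNorm, Real.rpow_eq_zero (bic_nonneg ..) (by positivity), bic_eq_zero_iff L A B hb ha]

theorem edgeNorm_filter_le {Ω : Type*} (L : Set Ω) (A B : Finset Ω) (c : Ω) {n b : ℕ}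
    (hn : 0 < n) (hb : 0 < b) :
    edgeNorm L (A.filter (Compat L c)) B n b ≤
      edgeNorm L A B (n + 1) b * condFactor L A B n b c := by
  rw [condFactor_eq]
  -- If the denominator of `condFactor` vanishes, its value is 0 by convention. There are then no
  -- compatible colors at all, so the left side vanishes too.
  by_cases h : edgeNorm L A B (n + 1) b = 0
  · rw [h, zero_mul]
    rw [edgeNorm_eq_zero_iff L A B n.succ_pos hb] at h
    refine le_of_eq ?_
    rw [edgeNorm_eq_zero_iff L _ B hn hb]
    exact fun x hx => h x (Finset.mem_of_mem_filter x hx)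
  · rw [mul_div_cancel₀ _ h]

/-- The factors on the right telescope through the intermediate degrees `(n, p + 1)`; what remains
is `bic_filter_filter_mul_le`. The two ends play different roles, so exchanging them yields a
second, different bound. -/
theorem edgeNorm_filter_filter_le {Ω : Type*} [Finite Ω] (L : Set Ω) (A B : Finset Ω) (c : Ω)
    {n p : ℕ} (hn : 0 < n) (hp : 0 < p) :
    edgeNorm L (A.filter (Compat L c)) (B.filter (Compat L c)) n p ≤
      edgeNorm L A B (n + 1) (p + 1) *
        (condFactor L A B n (p + 1) c * condFactor L B A p n c) := by
  have key : edgeNorm L (A.filter (Compat L c)) (B.filter (Compat L c)) n p *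
      edgeNorm L A B n (p + 1) ≤ edgeNorm L (A.filter (Compat L c)) B n (p + 1) *
        edgeNorm L A (B.filter (Compat L c)) n p := bic_filter_filter_mul_le L A B c hp
  rw [condFactor_eq, condFactor_eq, edgeNorm_comm L (B.filter _) A, edgeNorm_comm L B A]
  by_cases h : ∀ x ∈ A, ∀ y ∈ B, ¬ Compat L x y
  · rw [(edgeNorm_eq_zero_iff L A B n.succ_pos p.succ_pos).2 h, zero_mul]
    refine le_of_eq ?_
    rw [edgeNorm_eq_zero_iff L _ _ hn hp]
    exact fun x hx y hy => h x (Finset.mem_of_mem_filter x hx) y (Finset.mem_of_mem_filter y hy)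
  · have h1 := mt (edgeNorm_eq_zero_iff L A B n.succ_pos p.succ_pos).1 h
    have h2 := mt (edgeNorm_eq_zero_iff L A B hn p.succ_pos).1 h
    have h2' := (edgeNorm_nonneg L A B n (p + 1)).lt_of_ne' h2
    rw [← mul_assoc, mul_div_cancel₀ _ h1, ← mul_div_assoc, le_div_iff₀ h2']
    exact key

/-! ### List colorings and conditioning on the color of one vertex. -/

/-- The semiproper colorings of `G` with lists `C`. -/
noncomputable def listColorings {V Ω : Type*} [Fintype V] [DecidableEq V] (G : SimpleGraph V)
    (L : Set Ω) (C : V → Finset Ω) : Finset (V → Ω) :=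
  open Classical in (Fintype.piFinset C).filter (IsSemiproper G L)

theorem mem_listColorings {V Ω : Type*} [Fintype V] [DecidableEq V] {G : SimpleGraph V}
    {L : Set Ω} {C : V → Finset Ω} {f : V → Ω} :
    f ∈ listColorings G L C ↔ (∀ v, f v ∈ C v) ∧ ∀ u v, G.Adj u v → Compat L (f u) (f v) := by
  simp [listColorings, IsSemiproper, Compat]

/-- The lists that remain for the other vertices once `w` has received the color `c`. -/
noncomputable def condList {V Ω : Type*} [DecidableEq V] (G : SimpleGraph V) [DecidableRel G.Adj]
    (L : Set Ω) (C : V → Finset Ω) (w : V) (c : Ω) (v : V) : Finset Ω :=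
  if v = w then {c} else if G.Adj w v then (C v).filter (Compat L c) else C v

theorem card_listColorings_eq_sum {V Ω : Type*} [Fintype V] [DecidableEq V] (G : SimpleGraph V)
    [DecidableRel G.Adj] (L : Set Ω) (C : V → Finset Ω) (w : V) :
    (listColorings G L C).card =
      ∑ c ∈ C w, (listColorings (G.deleteIncidenceSet w) L (condList G L C w c)).card := by
  classical
  rw [Finset.card_eq_sum_card_fiberwise (f := fun f => f w) (t := C w)]
  · refine Finset.sum_congr rfl fun c hc => ?_
    congr 1
    ext f
    simp only [Finset.mem_filter, mem_listColorings, SimpleGraph.deleteIncidenceSet_adj]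
    constructor
    · rintro ⟨⟨h1, h2⟩, rfl⟩
      refine ⟨fun v => ?_, fun u v h => h2 u v h.1⟩
      rw [condList]
      split_ifs with hv hadj
      · simp [hv]
      · exact Finset.mem_filter.2 ⟨h1 v, h2 _ _ hadj⟩
      · exact h1 v
    · rintro ⟨h1, h2⟩
      have hw : f w = c := by simpa [condList] using h1 w
      have hnb : ∀ v, G.Adj w v → Compat L c (f v) := by
        intro v hv
        have := h1 v
        rw [condList, if_neg hv.ne', if_pos hv] at this
        exact (Finset.mem_filter.1 this).2
      refine ⟨⟨fun v => ?_, fun u v h => ?_⟩, hw⟩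
      · have := h1 v
        rw [condList] at this
        split_ifs at this with hv hadj
        · rw [hv, hw]; exact hc
        · exact Finset.mem_of_mem_filter _ this
        · exact this
      · by_cases hu : u = w
        · subst hu; rw [hw]; exact hnb v h
        · by_cases hv : v = w
          · subst hv; rw [hw]; exact (hnb u h.symm).symm
          · exact h2 u v ⟨h, hu, hv⟩
  · intro f hf
    exact (mem_listColorings.1 hf).1 w

theorem degree_deleteIncidenceSet_self {V : Type*} [Fintype V] [DecidableEq V]
    (G : SimpleGraph V) [DecidableRel G.Adj] (w : V) : (G.deleteIncidenceSet w).degree w = 0 := by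
  rw [← SimpleGraph.card_neighborFinset_eq_degree, Finset.card_eq_zero,
    Finset.eq_empty_iff_forall_notMem]
  simp [SimpleGraph.deleteIncidenceSet_adj]

theorem degree_deleteIncidenceSet_of_adj {V : Type*} [Fintype V] [DecidableEq V]
    (G : SimpleGraph V) [DecidableRel G.Adj] {w v : V} (h : G.Adj w v) :
    (G.deleteIncidenceSet w).degree v = G.degree v - 1 := by
  rw [← SimpleGraph.card_neighborFinset_eq_degree, ← SimpleGraph.card_neighborFinset_eq_degree,
    ← Finset.card_erase_of_mem (by simpa using h.symm : w ∈ G.neighborFinset v)]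
  congr 1
  ext u
  simp only [SimpleGraph.mem_neighborFinset, SimpleGraph.deleteIncidenceSet_adj, Finset.mem_erase]
  have := h.ne'
  tauto

theorem degree_deleteIncidenceSet_of_not_adj {V : Type*} [Fintype V] [DecidableEq V]
    (G : SimpleGraph V) [DecidableRel G.Adj] {w v : V} (hv : v ≠ w) (h : ¬ G.Adj w v) :
    (G.deleteIncidenceSet w).degree v = G.degree v := by
  rw [← SimpleGraph.card_neighborFinset_eq_degree, ← SimpleGraph.card_neighborFinset_eq_degree]
  congr 1
  ext u
  simp only [SimpleGraph.mem_neighborFinset, SimpleGraph.deleteIncidenceSet_adj]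
  refine ⟨fun h => h.1, fun hu => ⟨hu, hv, ?_⟩⟩
  rintro rfl
  exact h hu.symm

/-! ### The upper bound and its change under conditioning. -/

/-- The factor that a vertex contributes to the upper bound when it is isolated. -/
noncomputable def isoFactor {V Ω : Type*} [Fintype V] (G : SimpleGraph V)
    [DecidableRel G.Adj] (C : V → Finset Ω) (v : V) : ℝ :=
  if G.degree v = 0 then ((C v).card : ℝ) else 1

/-- The factor of the edge `uv`. -/
noncomputable def pairNorm {V Ω : Type*} [Fintype V] (G : SimpleGraph V)
    [DecidableRel G.Adj] (L : Set Ω) (C : V → Finset Ω) (u v : V) : ℝ :=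
  edgeNorm L (C u) (C v) (G.degree u) (G.degree v)

/-- The upper bound for the number of semiproper list colorings; isolated vertices are allowed, and
the contribution of each edge is divided equally between its two orientations. -/
noncomputable def coloringBound {V Ω : Type*} [Fintype V] (G : SimpleGraph V)
    [DecidableRel G.Adj] (L : Set Ω) (C : V → Finset Ω) : ℝ :=
  (∏ v, isoFactor G C v) *
    ∏ u, ∏ v, if G.Adj u v then √(pairNorm G L C u v) else 1

/-- The share of `u` in the change of the factor of the edge `uv` when `w` receives the
color `c`. -/
noncomputable def pairChange {V Ω : Type*} [Fintype V] (G : SimpleGraph V)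
    [DecidableRel G.Adj] (L : Set Ω) (C : V → Finset Ω) (w : V) (c : Ω) (u v : V) : ℝ :=
  if G.Adj w u then
    if G.Adj w v then
      √(condFactor L (C u) (C v) (G.degree u - 1) (G.degree v) c *
        condFactor L (C u) (C v) (G.degree u - 1) (G.degree v - 1) c)
    else condFactor L (C u) (C v) (G.degree u - 1) (G.degree v) c
  else 1

theorem pairNorm_nonneg {V Ω : Type*} [Fintype V] (G : SimpleGraph V)
    [DecidableRel G.Adj] (L : Set Ω) (C : V → Finset Ω) (u v : V) : 0 ≤ pairNorm G L C u v :=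
  edgeNorm_nonneg ..

theorem pairNorm_comm {V Ω : Type*} [Fintype V] [Finite Ω] (G : SimpleGraph V)
    [DecidableRel G.Adj] (L : Set Ω) (C : V → Finset Ω) (u v : V) :
    pairNorm G L C u v = pairNorm G L C v u :=
  edgeNorm_comm ..

theorem pairChange_nonneg {V Ω : Type*} [Fintype V] (G : SimpleGraph V)
    [DecidableRel G.Adj] (L : Set Ω) (C : V → Finset Ω) (w : V) (c : Ω) (u v : V) :
    0 ≤ pairChange G L C w c u v := by
  rw [pairChange]
  split_ifs
  · positivity
  · exact condFactor_nonneg ..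
  · exact zero_le_one

/-- Ensures that an endpoint of a surviving edge keeps positive degree when its edge to `w` is
deleted. -/
theorem two_le_degree_of_adj {V : Type*} [Fintype V] [DecidableEq V] (G : SimpleGraph V)
    [DecidableRel G.Adj] {u v w : V} (hv : G.Adj u v) (hw : G.Adj u w) (h : v ≠ w) :
    2 ≤ G.degree u := by
  rw [← SimpleGraph.card_neighborFinset_eq_degree, ← Finset.card_pair h]
  refine Finset.card_le_card fun x hx => ?_
  rw [Finset.mem_insert, Finset.mem_singleton] at hx
  rcases hx with rfl | rfl <;> simpa

theorem pairNorm_condList_le {V Ω : Type*} [Fintype V] [DecidableEq V] [Finite Ω]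
    (G : SimpleGraph V) [DecidableRel G.Adj] (L : Set Ω) (C : V → Finset Ω) {w : V} (c : Ω)
    {u v : V} (huv : G.Adj u v) (hu : u ≠ w) (hv : v ≠ w) :
    pairNorm (G.deleteIncidenceSet w) L (condList G L C w c) u v ≤
      pairNorm G L C u v * (pairChange G L C w c u v * pairChange G L C w c v u) := by
  have onesided : ∀ {u v : V}, G.Adj u v → u ≠ w → v ≠ w → G.Adj w u → ¬ G.Adj w v →
      pairNorm (G.deleteIncidenceSet w) L (condList G L C w c) u v ≤
        pairNorm G L C u v * (pairChange G L C w c u v * pairChange G L C w c v u) := by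
    intro u v huv hu hv hwu hwv
    obtain ⟨n, hn⟩ := Nat.exists_eq_add_of_le' (two_le_degree_of_adj G huv hwu.symm hv)
    rw [pairNorm, degree_deleteIncidenceSet_of_adj G hwu,
      degree_deleteIncidenceSet_of_not_adj G hv hwv, pairNorm, pairChange, pairChange, condList,
      condList, if_neg hu, if_neg hv, if_pos hwu, if_neg hwv, if_pos hwu, if_neg hwv, if_neg hwv,
      mul_one, hn]
    exact edgeNorm_filter_le L (C u) (C v) c n.succ_pos
      ((G.degree_pos_iff_exists_adj v).2 ⟨u, huv.symm⟩)
  by_cases hwu : G.Adj w u <;> by_cases hwv : G.Adj w v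
  · obtain ⟨n, hn⟩ := Nat.exists_eq_add_of_le' (two_le_degree_of_adj G huv hwu.symm hv)
    obtain ⟨p, hp⟩ := Nat.exists_eq_add_of_le' (two_le_degree_of_adj G huv.symm hwv.symm hu)
    have h1 := edgeNorm_filter_filter_le L (C u) (C v) c n.succ_pos p.succ_pos
    have h2 := edgeNorm_filter_filter_le L (C v) (C u) c p.succ_pos n.succ_pos
    rw [edgeNorm_comm L ((C v).filter _), edgeNorm_comm L (C v)] at h2
    rw [pairNorm, degree_deleteIncidenceSet_of_adj G hwu, degree_deleteIncidenceSet_of_adj G hwv,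
      pairNorm, pairChange, pairChange, condList, condList, if_neg hu, if_neg hv, if_pos hwu,
      if_pos hwv, if_pos hwu, if_pos hwv, if_pos hwv, if_pos hwu, hn, hp]
    simp only [Nat.succ_eq_add_one, Nat.add_succ_sub_one,
      add_assoc, Nat.reduceAdd] at h1 h2 ⊢
    set e' := edgeNorm L ((C u).filter (Compat L c)) ((C v).filter (Compat L c)) (n + 1) (p + 1)
    set e := edgeNorm L (C u) (C v) (n + 2) (p + 2)
    have he' : 0 ≤ e' := edgeNorm_nonneg ..
    have he : 0 ≤ e := edgeNorm_nonneg ..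
    -- The geometric mean of the two bounds `h1` and `h2` treats both ends alike; this explains the
    -- square root in `pairChange`.
    rw [← Real.sqrt_mul (mul_nonneg (condFactor_nonneg ..) (condFactor_nonneg ..)),
      ← Real.sqrt_sq he', ← Real.sqrt_sq he, ← Real.sqrt_mul (sq_nonneg e)]
    refine Real.sqrt_le_sqrt ?_
    have := mul_le_mul h1 h2 he' (mul_nonneg he
      (mul_nonneg (condFactor_nonneg ..) (condFactor_nonneg ..)))
    refine le_trans (le_of_eq (sq e')) (this.trans (le_of_eq ?_))
    ring
  · exact onesided huv hu hv hwu hwv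
  · rw [pairNorm_comm, pairNorm_comm G, mul_comm (pairChange ..)]
    exact onesided huv.symm hv hu hwv hwu
  · rw [pairNorm, degree_deleteIncidenceSet_of_not_adj G hu hwu,
      degree_deleteIncidenceSet_of_not_adj G hv hwv, pairNorm, pairChange, pairChange, condList,
      condList, if_neg hu, if_neg hv, if_neg hwu, if_neg hwv, if_neg hwu, if_neg hwv, mul_one,
      mul_one]

/-- The factor by which the contribution of a neighbor `i` of `w` changes when `w` receives the
color `c`. -/
noncomputable def vertexChange {V Ω : Type*} [Fintype V] [DecidableEq V] (G : SimpleGraph V)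
    [DecidableRel G.Adj] (L : Set Ω) (C : V → Finset Ω) (w : V) (c : Ω) (i : V) : ℝ :=
  (if G.degree i = 1 then (((C i).filter (Compat L c)).card : ℝ) else 1) *
    ∏ j ∈ (G.neighborFinset i).erase w, pairChange G L C w c i j

theorem isoFactor_condList {V Ω : Type*} [Fintype V] [DecidableEq V] (G : SimpleGraph V)
    [DecidableRel G.Adj] (L : Set Ω) (C : V → Finset Ω) {w : V} (hw : 0 < G.degree w) (c : Ω)
    (v : V) :
    isoFactor (G.deleteIncidenceSet w) (condList G L C w c) v = isoFactor G C v *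
      if G.Adj w v then
        (if G.degree v = 1 then (((C v).filter (Compat L c)).card : ℝ) else 1) else 1 := by
  rw [isoFactor, isoFactor]
  by_cases hv : v = w
  · subst hv
    -- The vertex `w` becomes isolated with the one-color list `{c}`, so its factor is 1, as it was
    -- before.
    rw [degree_deleteIncidenceSet_self, if_pos rfl, if_neg hw.ne', if_neg (G.loopless.irrefl v),
      condList, if_pos rfl]
    simp
  by_cases hadj : G.Adj w v
  · have hd : 0 < G.degree v := (G.degree_pos_iff_exists_adj v).2 ⟨w, hadj.symm⟩
    have h1 : G.degree v - 1 = 0 ↔ G.degree v = 1 := by omega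
    rw [degree_deleteIncidenceSet_of_adj G hadj, if_pos hadj, if_neg hd.ne', condList, if_neg hv,
      if_pos hadj, one_mul]
    simp only [h1]
  · rw [degree_deleteIncidenceSet_of_not_adj G hv hadj, if_neg hadj, condList, if_neg hv,
      if_neg hadj, mul_one]

theorem coloringBound_condList_le {V Ω : Type*} [Fintype V] [DecidableEq V] [Finite Ω]
    (G : SimpleGraph V) [DecidableRel G.Adj] (L : Set Ω) (C : V → Finset Ω) {w : V}
    (hw : 0 < G.degree w) (c : Ω) :
    coloringBound (G.deleteIncidenceSet w) L (condList G L C w c) ≤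
      ((∏ v, isoFactor G C v) * ∏ u, ∏ v,
        if (G.deleteIncidenceSet w).Adj u v then √(pairNorm G L C u v) else 1) *
      ∏ i ∈ G.neighborFinset w, vertexChange G L C w c i := by
  classical
  have hiso0 : ∀ v, 0 ≤ isoFactor G C v := fun v => by
    rw [isoFactor]; split_ifs <;> positivity
  have hiso : ∏ v, isoFactor (G.deleteIncidenceSet w) (condList G L C w c) v =
      (∏ v, isoFactor G C v) * ∏ i ∈ G.neighborFinset w,
        (if G.degree i = 1 then (((C i).filter (Compat L c)).card : ℝ) else 1) := by
    simp only [isoFactor_condList G L C hw c, Finset.prod_mul_distrib]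
    rw [← Finset.prod_filter]
    congr 2
    ext v
    simp
  have hedge : ∀ u v, (if (G.deleteIncidenceSet w).Adj u v then
        √(pairNorm (G.deleteIncidenceSet w) L (condList G L C w c) u v) else 1) ≤
      (if (G.deleteIncidenceSet w).Adj u v then √(pairNorm G L C u v) else 1) *
      ((if (G.deleteIncidenceSet w).Adj u v then √(pairChange G L C w c u v) else 1) *
        (if (G.deleteIncidenceSet w).Adj u v then √(pairChange G L C w c v u) else 1)) := by
    intro u v
    split_ifs with h
    · rw [SimpleGraph.deleteIncidenceSet_adj] at h
      rw [← Real.sqrt_mul (pairChange_nonneg ..), ← Real.sqrt_mul (pairNorm_nonneg ..)]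
      exact Real.sqrt_le_sqrt (pairNorm_condList_le G L C c h.1 h.2.1 h.2.2)
    · simp
  have hchange : (∏ u, ∏ v,
      if (G.deleteIncidenceSet w).Adj u v then √(pairChange G L C w c u v) else 1) *
      (∏ u, ∏ v,
        if (G.deleteIncidenceSet w).Adj u v then √(pairChange G L C w c v u) else 1) =
      ∏ i ∈ G.neighborFinset w, ∏ j ∈ (G.neighborFinset i).erase w,
        pairChange G L C w c i j := by
    rw [Finset.prod_comm (f := fun u v =>
      if (G.deleteIncidenceSet w).Adj u v then √(pairChange G L C w c v u) else 1)]
    simp only [← Finset.prod_mul_distrib]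
    -- After renaming, each oriented pair collects two equal square roots, one from each orientation
    -- of its edge.
    have e : ∀ u v, (if (G.deleteIncidenceSet w).Adj u v then √(pairChange G L C w c u v) else 1) *
        (if (G.deleteIncidenceSet w).Adj v u then √(pairChange G L C w c u v) else 1) =
        if (G.deleteIncidenceSet w).Adj u v then pairChange G L C w c u v else 1 := by
      intro u v
      simp only [(G.deleteIncidenceSet w).adj_comm v u]
      split_ifs
      · exact Real.mul_self_sqrt (pairChange_nonneg ..)
      · exact one_mul 1
    simp only [e]
    rw [← Finset.prod_subset (Finset.subset_univ (G.neighborFinset w))]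
    · refine Finset.prod_congr rfl fun i hi => ?_
      rw [← Finset.prod_filter]
      refine Finset.prod_congr ?_ fun _ _ => rfl
      ext j
      have hiw : i ≠ w := ((G.mem_neighborFinset w i).1 hi).ne'
      simp [SimpleGraph.deleteIncidenceSet_adj, hiw, and_comm]
    · intro i _ hi
      rw [SimpleGraph.mem_neighborFinset] at hi
      simp [pairChange, hi]
  simp only [vertexChange]
  rw [Finset.prod_mul_distrib, coloringBound, hiso, ← hchange, mul_mul_mul_comm]
  refine mul_le_mul_of_nonneg_left ?_ (mul_nonneg (Finset.prod_nonneg fun v _ => hiso0 v)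
    (Finset.prod_nonneg fun i _ => by split_ifs <;> positivity))
  simp only [← Finset.prod_mul_distrib]
  refine Finset.prod_le_prod (fun u _ => Finset.prod_nonneg fun v _ => ?_) fun u _ =>
    Finset.prod_le_prod (fun v _ => ?_) fun v _ => hedge u v
  all_goals split_ifs <;> positivity

/-- Restores the deleted edges: each edge `wi` occurs in two orientations, and its two square roots
multiply to the full factor. -/
theorem prod_neighbor_pairNorm_mul {V Ω : Type*} [Fintype V] [DecidableEq V] [Finite Ω]
    (G : SimpleGraph V) [DecidableRel G.Adj] (L : Set Ω) (C : V → Finset Ω) (w : V) :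
    ((∏ v, isoFactor G C v) * ∏ u, ∏ v,
        if (G.deleteIncidenceSet w).Adj u v then √(pairNorm G L C u v) else 1) *
      ∏ i ∈ G.neighborFinset w, pairNorm G L C w i = coloringBound G L C := by
  classical
  rw [coloringBound, mul_assoc]
  congr 1
  have e : ∀ u v, (if G.Adj u v then √(pairNorm G L C u v) else 1) =
      (if (G.deleteIncidenceSet w).Adj u v then √(pairNorm G L C u v) else 1) *
      ((if u = w then (if G.Adj w v then √(pairNorm G L C w v) else 1) else 1) *
        (if v = w then (if G.Adj w u then √(pairNorm G L C w u) else 1) else 1)) := by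
    intro u v
    simp only [SimpleGraph.deleteIncidenceSet_adj]
    by_cases hu : u = w
    · subst hu
      by_cases hv : v = u
      · subst hv; simp
      · simp [hv]
    · by_cases hv : v = w
      · subst hv
        have := G.adj_comm u v
        rw [pairNorm_comm G L C u v]
        simp [hu, this]
      · simp [hu, hv]
  rw [Finset.prod_congr rfl fun u _ => Finset.prod_congr rfl fun v _ => e u v]
  simp only [Finset.prod_mul_distrib]
  congr 1
  have h1 : ∏ u, ∏ v, (if u = w then (if G.Adj w v then √(pairNorm G L C w v) else 1) else 1) =
      ∏ v, (if G.Adj w v then √(pairNorm G L C w v) else 1) := by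
    rw [Finset.prod_comm]
    simp
  have h2 : ∏ u, ∏ v, (if v = w then (if G.Adj w u then √(pairNorm G L C w u) else 1) else 1) =
      ∏ v, (if G.Adj w v then √(pairNorm G L C w v) else 1) := by
    simp
  rw [h1, h2, ← Finset.prod_filter, ← Finset.prod_mul_distrib]
  refine Finset.prod_congr (by ext; simp) fun i _ => ?_
  exact (Real.mul_self_sqrt (pairNorm_nonneg ..)).symm

/-! ### Hölder around the deleted vertex. -/

theorem pairChange_sum_pow_le {V Ω : Type*} [Fintype V] [DecidableEq V]
    (G : SimpleGraph V) [DecidableRel G.Adj] (L : Set Ω) (C : V → Finset Ω) (W : Finset Ω)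
    {w i j : V} (hmax : ∀ v, G.degree v ≤ G.degree w) (hi : G.Adj w i) (hij : G.Adj i j)
    (hj : j ≠ w) :
    ∑ c ∈ W, pairChange G L C w c i j ^ ((G.degree i - 1) * G.degree w) ≤
      bic L W (C i) (G.degree i) (G.degree w) ^ (1 / (G.degree i : ℝ)) := by
  obtain ⟨n, hn⟩ := Nat.exists_eq_add_of_le' (two_le_degree_of_adj G hij hi.symm hj)
  have hjpos : 0 < G.degree j := (G.degree_pos_iff_exists_adj j).2 ⟨i, hij.symm⟩
  have h1 := sum_condFactor_pow_le L (C i) (C j) W n.succ_pos hjpos (hmax j)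
  simp only [pairChange, if_pos hi]
  have e : (((n + 1 : ℕ) : ℝ) + 1) = ((n + 2 : ℕ) : ℝ) := by push_cast; ring
  rw [hn]
  simp only [Nat.succ_eq_add_one, e, add_assoc, Nat.reduceAdd, Nat.add_succ_sub_one] at h1 ⊢
  by_cases hwj : G.Adj w j
  · have hj2 := two_le_degree_of_adj G hij.symm hwj.symm hi.ne'
    have h2 := sum_condFactor_pow_le L (C i) (C j) W n.succ_pos (by omega : 0 < G.degree j - 1)
      ((Nat.sub_le _ _).trans (hmax j))
    simp only [Nat.succ_eq_add_one, e, add_assoc, Nat.reduceAdd] at h2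
    simp only [if_pos hwj]
    -- AM-GM loses nothing in the final estimate, since `h1` and `h2` bound the sums for the two
    -- ratios by the same quantity.
    have h3 : ∀ (m : ℕ) {x y : ℝ}, 0 ≤ x → 0 ≤ y → √(x * y) ^ m ≤ (x ^ m + y ^ m) / 2 := by
      intro m x y hx hy
      rw [Real.sqrt_mul hx, mul_pow]
      have ex : (√x ^ m) ^ 2 = x ^ m := by rw [pow_right_comm, Real.sq_sqrt hx]
      have ey : (√y ^ m) ^ 2 = y ^ m := by rw [pow_right_comm, Real.sq_sqrt hy]
      have := two_mul_le_add_sq (√x ^ m) (√y ^ m)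
      rw [ex, ey] at this
      linarith
    refine (Finset.sum_le_sum fun c _ =>
      h3 _ (condFactor_nonneg ..) (condFactor_nonneg ..)).trans ?_
    rw [← Finset.sum_div, Finset.sum_add_distrib]
    linarith
  · simpa only [if_neg hwj] using h1

/-- A leaf `i` becomes isolated, and its sum is the biclique count for a star. Otherwise Hölder is
applied over the `d_i - 1` remaining neighbors, and the `d_i - 1` equal bounds, each to the power `1
/ (d_i - 1)`, multiply to one. -/
theorem vertexChange_sum_pow_le {V Ω : Type*} [Fintype V] [DecidableEq V]
    (G : SimpleGraph V) [DecidableRel G.Adj] (L : Set Ω) (C : V → Finset Ω) (W : Finset Ω)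
    {w i : V} (hmax : ∀ v, G.degree v ≤ G.degree w) (hi : G.Adj w i) :
    ∑ c ∈ W, vertexChange G L C w c i ^ G.degree w ≤
      bic L W (C i) (G.degree i) (G.degree w) ^ (1 / (G.degree i : ℝ)) := by
  have hiw : w ∈ G.neighborFinset i := by simpa using hi.symm
  have hcard : ((G.neighborFinset i).erase w).card = G.degree i - 1 := by
    rw [Finset.card_erase_of_mem hiw, SimpleGraph.card_neighborFinset_eq_degree]
  have hipos : 0 < G.degree i := (G.degree_pos_iff_exists_adj i).2 ⟨w, hi.symm⟩
  by_cases h1 : G.degree i = 1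
  · have hempty : (G.neighborFinset i).erase w = ∅ := by
      rw [← Finset.card_eq_zero, hcard, h1]
    simp only [vertexChange, hempty, Finset.prod_empty, mul_one, h1, if_true]
    rw [Nat.cast_one, div_one, Real.rpow_one, bic]
    refine le_of_eq ?_
    refine Finset.sum_bij' (fun c _ _ => c) (fun x _ => x 0) ?_ ?_ ?_ ?_ ?_
    · intro c hc; simpa using hc
    · intro x hx; exact Fintype.mem_piFinset.1 hx 0
    · intro c _; rfl
    · intro x _; funext m; rw [Subsingleton.elim m 0]
    · intro c _
      congr 3
      ext y
      simp [mem_avail]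
  · have hne : ((G.neighborFinset i).erase w).Nonempty := by
      rw [← Finset.card_pos, hcard]; omega
    have hM : 0 ≤ bic L W (C i) (G.degree i) (G.degree w) := bic_nonneg ..
    simp only [vertexChange, if_neg h1, one_mul, ← Finset.prod_pow]
    refine (sum_prod_le_prod_sum_pow _ W
      (fun j c => pairChange G L C w c i j ^ G.degree w)
      (fun j _ c _ => pow_nonneg (pairChange_nonneg ..) _) hne).trans ?_
    rw [hcard]
    have hd : (0 : ℝ) < ((G.degree i - 1 : ℕ) : ℝ) := by
      have : 0 < G.degree i - 1 := by omega
      exact_mod_cast this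
    calc ∏ j ∈ (G.neighborFinset i).erase w,
          (∑ c ∈ W, (pairChange G L C w c i j ^ G.degree w) ^ (G.degree i - 1)) ^
            (1 / ((G.degree i - 1 : ℕ) : ℝ))
        ≤ ∏ j ∈ (G.neighborFinset i).erase w,
          (bic L W (C i) (G.degree i) (G.degree w) ^ (1 / (G.degree i : ℝ))) ^
            (1 / ((G.degree i - 1 : ℕ) : ℝ)) := by
          have hs0 : ∀ j, 0 ≤ ∑ c ∈ W,
              (pairChange G L C w c i j ^ G.degree w) ^ (G.degree i - 1) := fun j =>
            Finset.sum_nonneg fun c _ => pow_nonneg (pow_nonneg (pairChange_nonneg ..) _) _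
          refine Finset.prod_le_prod (fun j _ => Real.rpow_nonneg (hs0 j) _) fun j hj => ?_
          refine Real.rpow_le_rpow (hs0 j) ?_ (by positivity)
          rw [Finset.mem_erase, SimpleGraph.mem_neighborFinset] at hj
          refine le_trans (le_of_eq ?_) (pairChange_sum_pow_le G L C W hmax hi hj.2 hj.1)
          refine Finset.sum_congr rfl fun c _ => ?_
          rw [← pow_mul, mul_comm]
      _ = _ := by
          rw [Finset.prod_const, hcard, ← Real.rpow_natCast, ← Real.rpow_mul (by positivity),
            one_div_mul_cancel hd.ne', Real.rpow_one]

theorem sum_prod_vertexChange_le {V Ω : Type*} [Fintype V] [DecidableEq V]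
    (G : SimpleGraph V) [DecidableRel G.Adj] (L : Set Ω) (C : V → Finset Ω)
    {w : V} (hmax : ∀ v, G.degree v ≤ G.degree w) (hw : 0 < G.degree w) :
    ∑ c ∈ C w, ∏ i ∈ G.neighborFinset w, vertexChange G L C w c i ≤
      ∏ i ∈ G.neighborFinset w, pairNorm G L C w i := by
  have h0 : ∀ c i, 0 ≤ vertexChange G L C w c i := fun c i =>
    mul_nonneg (by split_ifs <;> positivity)
      (Finset.prod_nonneg fun j _ => pairChange_nonneg ..)
  refine (sum_prod_le_prod_sum_pow _ (C w) (fun i c => vertexChange G L C w c i)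
    (fun i _ c _ => h0 c i) (by rw [← Finset.card_pos]; simpa using hw)).trans ?_
  rw [SimpleGraph.card_neighborFinset_eq_degree]
  have hs0 : ∀ i, 0 ≤ ∑ c ∈ C w, vertexChange G L C w c i ^ G.degree w := fun i =>
    Finset.sum_nonneg fun c _ => pow_nonneg (h0 c i) _
  refine Finset.prod_le_prod (fun i _ => Real.rpow_nonneg (hs0 i) _) fun i hi => ?_
  rw [SimpleGraph.mem_neighborFinset] at hi
  refine (Real.rpow_le_rpow (hs0 i) (vertexChange_sum_pow_le G L C (C w) hmax hi)
    (by positivity)).trans (le_of_eq ?_)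
  rw [← Real.rpow_mul (bic_nonneg ..), pairNorm, edgeNorm, div_mul_div_comm, one_mul]

/-! ### The induction, and the passage to products over edges. -/

theorem card_listColorings_le_coloringBound {V Ω : Type*} [Fintype V] [DecidableEq V] [Finite Ω]
    (G : SimpleGraph V) [DecidableRel G.Adj] (L : Set Ω) (C : V → Finset Ω) :
    ((listColorings G L C).card : ℝ) ≤ coloringBound G L C := by
  induction h : G.edgeFinset.card using Nat.strong_induction_on generalizing G C with
  | _ N ih =>
  by_cases hdeg : ∀ v, G.degree v = 0
  · have hadj : ∀ u v, ¬ G.Adj u v := fun u v huv =>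
      ((G.degree_pos_iff_exists_adj u).2 ⟨v, huv⟩).ne' (hdeg u)
    have : coloringBound G L C = ((Fintype.piFinset C).card : ℝ) := by
      simp [coloringBound, isoFactor, hdeg, hadj]
    rw [this]
    exact_mod_cast Finset.card_le_card fun f hf =>
      Fintype.mem_piFinset.2 (mem_listColorings.1 hf).1
  · push Not at hdeg
    obtain ⟨v0, hv0⟩ := hdeg
    -- Maximality of the degree of `w` supplies the hypothesis `r ≤ Δ` of `sum_condFactor_pow_le`.
    obtain ⟨w, -, hmax⟩ := Finset.exists_max_image Finset.univ (fun v => G.degree v)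
      ⟨v0, Finset.mem_univ _⟩
    replace hmax : ∀ v, G.degree v ≤ G.degree w := fun v => hmax v (Finset.mem_univ _)
    have hw : 0 < G.degree w := (Nat.pos_of_ne_zero hv0).trans_le (hmax v0)
    have hlt : (G.deleteIncidenceSet w).edgeFinset.card < N := by
      have h1 := G.card_edgeFinset_deleteIncidenceSet w
      have h2 := G.degree_le_card_edgeFinset w
      omega
    have hR : 0 ≤ (∏ v, isoFactor G C v) * ∏ u, ∏ v,
        if (G.deleteIncidenceSet w).Adj u v then √(pairNorm G L C u v) else 1 := by
      refine mul_nonneg (Finset.prod_nonneg fun v _ => ?_)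
        (Finset.prod_nonneg fun u _ => Finset.prod_nonneg fun v _ => ?_)
      · rw [isoFactor]; split_ifs <;> positivity
      · split_ifs <;> positivity
    rw [card_listColorings_eq_sum G L C w, ← prod_neighbor_pairNorm_mul G L C w]
    push_cast
    refine le_trans (Finset.sum_le_sum fun c _ =>
      (ih _ hlt (G.deleteIncidenceSet w) (condList G L C w c) rfl).trans
        (coloringBound_condList_le G L C hw c)) ?_
    rw [← Finset.mul_sum]
    exact mul_le_mul_of_nonneg_left (sum_prod_vertexChange_le G L C hmax hw) hR

theorem prod_prod_sqrt_eq_prod_edgeFinset {V : Type*} [Fintype V] [DecidableEq V]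
    (G : SimpleGraph V) [DecidableRel G.Adj] (F : Sym2 V → ℝ) (hF : ∀ e, 0 ≤ F e) :
    (∏ u, ∏ v, if G.Adj u v then √(F s(u, v)) else 1) = ∏ e ∈ G.edgeFinset, F e := by
  rw [← Fintype.prod_prod_type' (f := fun u v => if G.Adj u v then √(F s(u, v)) else 1),
    ← Finset.prod_filter,
    ← Finset.prod_fiberwise_of_maps_to (g := fun p : V × V => s(p.1, p.2)) (t := G.edgeFinset)]
  · refine Finset.prod_congr rfl fun e he => ?_
    induction e with
    | _ a b =>
    rw [SimpleGraph.mem_edgeFinset, SimpleGraph.mem_edgeSet] at he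
    have : (Finset.univ.filter fun p : V × V => G.Adj p.1 p.2).filter
        (fun p => s(p.1, p.2) = s(a, b)) = {(a, b), (b, a)} := by
      ext ⟨x, y⟩
      simp only [Finset.mem_filter, Finset.mem_univ, true_and, Sym2.eq_iff, Finset.mem_insert,
        Finset.mem_singleton, Prod.mk.injEq]
      refine ⟨fun h => h.2, fun h => ⟨?_, h⟩⟩
      rcases h with ⟨rfl, rfl⟩ | ⟨rfl, rfl⟩
      · exact he
      · exact he.symm
    rw [this, Finset.prod_pair (by simp [he.ne]), Sym2.eq_swap (a := b), Real.mul_self_sqrt (hF _)]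
  · rintro ⟨u, v⟩ h
    simpa using h

theorem listEdgeFactor_nonneg {V Ω : Type*} [Fintype V] (G : SimpleGraph V) [DecidableRel G.Adj]
    (L : Set Ω) (C : V → Set Ω) (e : Sym2 V) : 0 ≤ listEdgeFactor G L C e := by
  induction e with
  | _ u v => exact Real.rpow_nonneg (Nat.cast_nonneg _) _

theorem numSemiproperList_le {V Ω : Type*} [Fintype V] [DecidableEq V] [Finite Ω]
    (G : SimpleGraph V) [DecidableRel G.Adj] (hG : ∀ v : V, 0 < G.degree v) (L : Set Ω)
    (C : V → Set Ω) :
    (numSemiproperList G L C : ℝ) ≤ ∏ e ∈ G.edgeFinset, listEdgeFactor G L C e := by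
  lift C to V → Finset Ω using fun v => Set.toFinite _
  have hnum : numSemiproperList G L (fun v => (C v : Set Ω)) = (listColorings G L C).card := by
    rw [numSemiproperList, ← Nat.card_eq_finsetCard]
    refine Nat.card_congr (Equiv.subtypeEquivRight fun f => ?_)
    rw [mem_listColorings, and_comm]
    rfl
  have hbound : coloringBound G L C =
      ∏ e ∈ G.edgeFinset, listEdgeFactor G L (fun v => (C v : Set Ω)) e := by
    rw [← prod_prod_sqrt_eq_prod_edgeFinset G _ (listEdgeFactor_nonneg G L _), coloringBound]
    have hiso : ∀ v, isoFactor G C v = 1 := fun v => if_neg (hG v).ne'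
    simp only [hiso, Finset.prod_const_one, one_mul]
    refine Finset.prod_congr rfl fun u _ => Finset.prod_congr rfl fun v _ => ?_
    congr 2
    rw [pairNorm, edgeNorm, ← bicliqueCount_eq_bic, mul_comm (G.degree v : ℝ)]
    rfl
  rw [← hbound, hnum]
  exact card_listColorings_le_coloringBound G L C

theorem homCount_eq_numSemiproperList {V : Type*} (G : SimpleGraph V) (q ℓ : ℕ) :
    homCount G (partiallyLoopedComplete q ℓ) =
      numSemiproperList G {i : Fin q | i.val < ℓ} (fun _ => Set.univ) := by
  have key : ∀ i j : Fin q, partiallyLoopedComplete q ℓ i j ↔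
      (i = j → i ∈ {i : Fin q | i.val < ℓ}) := by
    intro i j
    rw [partiallyLoopedComplete, Set.mem_ofPred_eq]
    tauto
  refine Nat.card_congr
    { toFun := fun f => ⟨f, fun u v h => (key _ _).1 (f.map_rel h), fun _ => Set.mem_univ _⟩
      invFun := fun f => ⟨f.1, fun {u v} h => (key _ _).2 (f.2.1 u v h)⟩
      left_inv := fun f => rfl
      right_inv := fun f => rfl }

theorem homEdgeFactor_eq_listEdgeFactor {V : Type*} [Fintype V] (G : SimpleGraph V)
    [DecidableRel G.Adj] (q ℓ : ℕ) (e : Sym2 V) :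
    homEdgeFactor G (partiallyLoopedComplete q ℓ) e =
      listEdgeFactor G {i : Fin q | i.val < ℓ} (fun _ => Set.univ) e := by
  induction e with
  | _ u v =>
  have : ∀ a b : ℕ, homCount (completeBipartiteGraph (Fin a) (Fin b))
      (partiallyLoopedComplete q ℓ) =
        bicliqueCount {i : Fin q | i.val < ℓ} Set.univ Set.univ a b := by
    intro a b
    rw [homCount_eq_numSemiproperList, bicliqueCount]
    congr 1
    funext x
    cases x <;> rfl
  simp only [homEdgeFactor, listEdgeFactor, Sym2.lift_mk]
  rw [this, bicliqueCount_comm]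

theorem mainTheorem4 {V Ω : Type*} [Fintype V] [DecidableEq V] [Finite Ω]
    (G : SimpleGraph V) [DecidableRel G.Adj] (hG : ∀ v : V, 0 < G.degree v) (L : Set Ω) :
    (∀ C : V → Set Ω,
      (numSemiproperList G L C : ℝ) ≤ ∏ e ∈ G.edgeFinset, listEdgeFactor G L C e) ∧
    (∀ q ℓ : ℕ, ℓ ≤ q →
      (homCount G (partiallyLoopedComplete q ℓ) : ℝ) ≤
        ∏ e ∈ G.edgeFinset, homEdgeFactor G (partiallyLoopedComplete q ℓ) e) := by
  refine ⟨numSemiproperList_le G hG L, fun q ℓ _ => ?_⟩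
  rw [homCount_eq_numSemiproperList]
  simp only [homEdgeFactor_eq_listEdgeFactor]
  exact numSemiproperList_le G hG _ _
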